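/- Let $d\ge 1$. A convex body in $\mathbb{R}^d$ is a compact convex set with nonempty interior, and a homothet of $C$ is a set $\lambda C+x$ with $\lambda>0$ and $x\in\mathbb{R}^d$. There is a constant $c=c(d)>0$, depending only on $d$, such that the following two statements hold for every convex body $C\subset\mathbb{R}^d$. (1) Let $k$ be a positive integer and let $S\subset\mathbb{R}^d$ be a finite set with $|S|\ge k$ such that the boundary of every homothet of $C$ contains at most $k/2$ points of $S$. Let $g(C,k,S)$ be the maximum number of homothets of $C$ with pairwise disjoint interiors, each containing at least $k$ points of $S$. Then $$g(C,k,S)\ \ge\ c\,\frac{|S|}{k}.$$ (2) Let $k>0$ be a real number and let $\mu$ be a $C$-nice measure with $\mu(\mathbb{R}^d)\ge k$, where $C$-nice means that $\mu$ is a finite Borel measure on $\mathbb{R}^d$ that vanishes on the boundary of every homothet of $C$ and satisfies $\mu(K)=\mu(\mathbb{R}^d)$ for some ball $K$. Let $g(C,k,\mu)$ be the maximum number of homothets of $C$ with pairwise disjoint interiors, each of $\mu$-measure at least $k$. Then $$g(C,k,\mu)\ \ge\ c\,\frac{\mu(\mathbb{R}^d)}{k}.$$ -/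

import Mathlib

open MeasureTheory
open scoped ENNReal

namespace HomothetPacking

/-- A convex body in `ℝ^d`: a convex compact set with nonempty interior. -/
structure IsConvexBody {d : ℕ} (C : Set (EuclideanSpace ℝ (Fin d))) : Prop where
  convex : Convex ℝ C
  isCompact : IsCompact C
  nonempty_interior : (interior C).Nonempty

/-- `A` is a (positive) homothet of `C`: `A = l C + x` for some `l > 0` and some point `x`. -/
def IsHomothet {d : ℕ} (C A : Set (EuclideanSpace ℝ (Fin d))) : Prop :=
  ∃ (l : ℝ) (x : EuclideanSpace ℝ (Fin d)), 0 < l ∧ A = (fun c => l • c + x) '' C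

/-- `S` is non-`t/C`-degenerate: the boundary of every homothet of `C` contains at most `t`
points of `S`. -/
def NonDegenerateSet {d : ℕ} (C : Set (EuclideanSpace ℝ (Fin d))) (t : ℝ)
    (S : Finset (EuclideanSpace ℝ (Fin d))) : Prop :=
  ∀ A, IsHomothet C A → (((S : Set (EuclideanSpace ℝ (Fin d))) ∩ frontier A).ncard : ℝ) ≤ t

/-- `μ` is non-`C`-degenerate: it vanishes on the boundary of every homothet of `C`. -/
def NonDegenerateMeasure {d : ℕ} (C : Set (EuclideanSpace ℝ (Fin d)))
    (μ : Measure (EuclideanSpace ℝ (Fin d))) : Prop :=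
  ∀ A, IsHomothet C A → μ (frontier A) = 0

/-- `μ` is `C`-nice: finite, non-`C`-degenerate, and carried by some ball. -/
structure IsNice {d : ℕ} (C : Set (EuclideanSpace ℝ (Fin d)))
    (μ : Measure (EuclideanSpace ℝ (Fin d))) : Prop where
  finite : μ Set.univ < ∞
  nonDegenerate : NonDegenerateMeasure C μ
  ball : ∃ (x : EuclideanSpace ℝ (Fin d)) (r : ℝ), 0 < r ∧ μ (Metric.ball x r) = μ Set.univ

/-- `A` is a `k⁺/S`-homothet of `C`: a homothet containing at least `k` points of `S`. -/
def IsPlusHomothetSet {d : ℕ} (C : Set (EuclideanSpace ℝ (Fin d))) (k : ℝ)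
    (S : Finset (EuclideanSpace ℝ (Fin d))) (A : Set (EuclideanSpace ℝ (Fin d))) : Prop :=
  IsHomothet C A ∧ k ≤ (((S : Set (EuclideanSpace ℝ (Fin d))) ∩ A).ncard : ℝ)

/-- `A` is a `k⁺/μ`-homothet of `C`: a homothet with `μ A ≥ k`. -/
def IsPlusHomothetMeasure {d : ℕ} (C : Set (EuclideanSpace ℝ (Fin d))) (k : ℝ)
    (μ : Measure (EuclideanSpace ℝ (Fin d))) (A : Set (EuclideanSpace ℝ (Fin d))) : Prop :=
  IsHomothet C A ∧ ENNReal.ofReal k ≤ μ A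

/-- The largest cardinality of a family of sets with property `Q` and with pairwise disjoint
interiors, as an element of `ℕ∞`. -/
noncomputable def maxPacking {d : ℕ} (Q : Set (EuclideanSpace ℝ (Fin d)) → Prop) : ℕ∞ :=
  ⨆ (P : Set (Set (EuclideanSpace ℝ (Fin d))))
    (_ : (∀ A ∈ P, Q A) ∧ P.PairwiseDisjoint interior), P.encard

/-- `g(C, k, S)`: the maximum number of interior disjoint `k⁺/S`-homothets of `C`. -/
noncomputable def gSet {d : ℕ} (C : Set (EuclideanSpace ℝ (Fin d))) (k : ℝ)
    (S : Finset (EuclideanSpace ℝ (Fin d))) : ℕ∞ :=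
  maxPacking (IsPlusHomothetSet C k S)

/-- `g(C, k, μ)`: the maximum number of interior disjoint `k⁺/μ`-homothets of `C`. -/
noncomputable def gMeasure {d : ℕ} (C : Set (EuclideanSpace ℝ (Fin d))) (k : ℝ)
    (μ : Measure (EuclideanSpace ℝ (Fin d))) : ℕ∞ :=
  maxPacking (IsPlusHomothetMeasure C k μ)

end HomothetPacking

namespace HomothetPacking

open Module Metric

/-! ### Covering numbers of bounded sets in finite dimension. -/

section Covering

/-! Both statements are one statement about a finite measure `μ` carried by a compact set `X` whose
atoms weigh less than `k`: counting measure on `S` for (1), `μ` itself for (2). A Helly argument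
centres `C` so that its gauge `p` satisfies `p (-x) ≤ d * p x`, which makes all constants depend on
`d` alone. In a fine enough unit, let `m x` be the least integer radius at which the homothet
centred at `x` has measure at least `k`; radius `m x - 1` then gives less than `k`. Greedily pick
`x` with `m x` minimal and discard every `y` whose homothet meets that of `x`. The discarded points
split into at most `2N` clusters, each inside some homothet of radius `m z - 1`, hence of measure at
most `k` (`measure_intersecting_le`). So about `μ univ / (2Nk)` picks are possible
(`exists_pairwise_disjoint_of_measure_lt`), and `c = 1 / (2N)`. -/

theorem card_le_of_separated_of_norm_le {F : Type*} [NormedAddCommGroup F] [NormedSpace ℝ F]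
    [FiniteDimensional ℝ F] {R : ℝ} (hR : 0 ≤ R) (s : Finset F) (hs : ∀ c ∈ s, ‖c‖ ≤ R)
    (h : ∀ c ∈ s, ∀ e ∈ s, c ≠ e → 1 ≤ ‖c - e‖) :
    s.card ≤ ⌊(2 * R + 1) ^ finrank ℝ F⌋₊ := by
  borelize F
  let ν : Measure F := Measure.addHaar
  have hρ : 0 < R + 1 / 2 := by positivity
  have hdisj : Set.Pairwise (s : Set F) (Function.onFun Disjoint fun c => ball c (1 / 2 : ℝ)) := by
    intro c hc e he hce
    apply ball_disjoint_ball
    rw [dist_eq_norm]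
    linarith [h c hc e he hce]
  -- Volume comparison: disjoint balls of radius 1/2 inside one ball of radius `R + 1/2`.
  have hsub : (⋃ c ∈ s, ball c (1 / 2 : ℝ)) ⊆ ball (0 : F) (R + 1 / 2) := by
    refine Set.iUnion₂_subset fun x hx => ball_subset_ball' ?_
    rw [dist_zero_right]
    linarith [hs x hx]
  have hvol : (s.card : ℝ≥0∞) * ENNReal.ofReal ((1 / 2 : ℝ) ^ finrank ℝ F) * ν (ball 0 1) ≤
      ENNReal.ofReal ((R + 1 / 2) ^ finrank ℝ F) * ν (ball 0 1) := by
    have := measure_mono (μ := ν) hsub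
    rw [measure_biUnion_finset hdisj fun c _ => measurableSet_ball,
      ν.addHaar_ball_of_pos _ hρ] at this
    simpa only [ν.addHaar_ball_of_pos _ (by norm_num : (0 : ℝ) < 1 / 2), Finset.sum_const,
      nsmul_eq_mul, mul_assoc] using this
  have hcard : (s.card : ℝ≥0∞) * ENNReal.ofReal ((1 / 2 : ℝ) ^ finrank ℝ F) ≤
      ENNReal.ofReal ((R + 1 / 2) ^ finrank ℝ F) :=
    (ENNReal.mul_le_mul_iff_left (measure_ball_pos _ _ zero_lt_one).ne' measure_ball_lt_top.ne).1
      hvol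
  apply Nat.le_floor
  have hreal := ENNReal.toReal_le_of_le_ofReal (by positivity) hcard
  rw [ENNReal.toReal_mul, ENNReal.toReal_natCast, ENNReal.toReal_ofReal (by positivity)] at hreal
  calc (s.card : ℝ) = s.card * (1 / 2 : ℝ) ^ finrank ℝ F * 2 ^ finrank ℝ F := by
        rw [mul_assoc, ← mul_pow]; norm_num
    _ ≤ (R + 1 / 2) ^ finrank ℝ F * 2 ^ finrank ℝ F := by gcongr
    _ = (2 * R + 1) ^ finrank ℝ F := by rw [← mul_pow]; congr 1; ring

/-- A 1-separated subset of `T` of maximal cardinality is a 1-net; the volume bound makes the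
maximum exist. -/
theorem exists_finset_norm_cover {F : Type*} [NormedAddCommGroup F] [NormedSpace ℝ F]
    [FiniteDimensional ℝ F] {R : ℝ} (hR : 0 ≤ R) (T : Set F) (hT : ∀ y ∈ T, ‖y‖ ≤ R) :
    ∃ s : Finset F, s.card ≤ ⌊(2 * R + 1) ^ finrank ℝ F⌋₊ ∧ ∀ y ∈ T, ∃ f ∈ s, ‖y - f‖ < 1 := by
  classical
  let P : ℕ → Prop := fun n => ∃ s : Finset F, s.card = n ∧ (s : Set F) ⊆ T ∧
    ∀ c ∈ s, ∀ e ∈ s, c ≠ e → 1 ≤ ‖c - e‖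
  set N := ⌊(2 * R + 1) ^ finrank ℝ F⌋₊
  have hP0 : P 0 := ⟨∅, by simp⟩
  have hPN : P (Nat.findGreatest P N) := Nat.findGreatest_spec (Nat.zero_le N) hP0
  obtain ⟨s, hcard, hsT, hsep⟩ := hPN
  refine ⟨s, hcard.trans_le (Nat.findGreatest_le N), fun y hy => ?_⟩
  by_contra! hcon
  have hys : y ∉ s := fun hys => by simpa using (hcon y hys).trans_lt' zero_lt_one
  have hP : P (s.card + 1) := by
    refine ⟨insert y s, Finset.card_insert_of_notMem hys, ?_, ?_⟩
    · rw [Finset.coe_insert]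
      exact Set.insert_subset hy hsT
    · intro c hc e he hce
      rw [Finset.mem_insert] at hc he
      rcases hc with rfl | hc <;> rcases he with rfl | he
      · exact absurd rfl hce
      · exact hcon e he
      · rw [norm_sub_rev]; exact hcon c hc
      · exact hsep c hc e he hce
  have hle : s.card + 1 ≤ N := by
    obtain ⟨t, ht, htT, htsep⟩ := hP
    rw [← ht]
    exact card_le_of_separated_of_norm_le hR t (fun c hc => hT c (htT hc)) htsep
  have := Nat.le_findGreatest hle hP
  omega

theorem exists_finset_seminorm_cover {F : Type*} [AddCommGroup F] [Module ℝ F]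
    [FiniteDimensional ℝ F] (q : Seminorm ℝ F) (hq : ∀ x, q x = 0 → x = 0) {R : ℝ} (hR : 0 ≤ R)
    (T : Set F) (hT : ∀ y ∈ T, q y ≤ R) :
    ∃ s : Finset F, s.card ≤ ⌊(2 * R + 1) ^ finrank ℝ F⌋₊ ∧ ∀ y ∈ T, ∃ f ∈ s, q (y - f) < 1 := by
  let _ : NormedAddCommGroup F := AddGroupNorm.toNormedAddCommGroup
    { q.toAddGroupSeminorm with eq_zero_of_map_eq_zero' := hq }
  let _ : NormedSpace ℝ F := ⟨fun a x => (map_smul_eq_mul q a x).le⟩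
  exact exists_finset_norm_cover hR T hT

end Covering

/-! ### Asymmetric gauges and clustering. -/

/-- A positive definite, positively homogeneous, subadditive function that is comparable with the
norm and whose asymmetry is bounded by `D`. -/
structure IsAsymmetricGauge {E : Type*} [NormedAddCommGroup E] [NormedSpace ℝ E] (D : ℝ)
    (p : E → ℝ) : Prop where
  add_le : ∀ x y, p (x + y) ≤ p x + p y
  smul : ∀ (t : ℝ) (x), 0 ≤ t → p (t • x) = t * p x
  neg_le : ∀ x, p (-x) ≤ D * p x
  exists_le_norm : ∃ a : ℝ, 0 < a ∧ ∀ x, p x ≤ a * ‖x‖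
  exists_norm_le : ∃ b : ℝ, 0 < b ∧ ∀ x, ‖x‖ ≤ b * p x

namespace IsAsymmetricGauge

variable {E : Type*} [NormedAddCommGroup E] [NormedSpace ℝ E] {D : ℝ} {p : E → ℝ}

theorem nonneg (hp : IsAsymmetricGauge D p) (x : E) : 0 ≤ p x := by
  obtain ⟨b, hb, h⟩ := hp.exists_norm_le
  exact nonneg_of_mul_nonneg_right ((norm_nonneg x).trans (h x)) hb

theorem map_zero (hp : IsAsymmetricGauge D p) : p 0 = 0 := by
  simpa using hp.smul 0 0 le_rfl

theorem const_mul (hp : IsAsymmetricGauge D p) {t : ℝ} (ht : 0 < t) :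
    IsAsymmetricGauge D (fun x => t * p x) where
  add_le x y := by
    rw [← mul_add]
    exact mul_le_mul_of_nonneg_left (hp.add_le x y) ht.le
  smul s x hs := by rw [hp.smul s x hs]; ring
  neg_le x := by
    calc t * p (-x) ≤ t * (D * p x) := mul_le_mul_of_nonneg_left (hp.neg_le x) ht.le
      _ = D * (t * p x) := by ring
  exists_le_norm := by
    obtain ⟨a, ha, h⟩ := hp.exists_le_norm
    refine ⟨t * a, by positivity, fun x => ?_⟩
    rw [mul_assoc]
    exact mul_le_mul_of_nonneg_left (h x) ht.le
  exists_norm_le := by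
    obtain ⟨b, hb, h⟩ := hp.exists_norm_le
    refine ⟨b / t, by positivity, fun x => ?_⟩
    rw [← mul_assoc, div_mul_cancel₀ _ ht.ne']
    exact h x

/-- The symmetrization of an asymmetric gauge. -/
def toSeminorm (hp : IsAsymmetricGauge D p) : Seminorm ℝ E :=
  Seminorm.of (fun x => 4 * (p x + p (-x)))
    (fun x y => by
      have h1 := hp.add_le x y
      have h2 := hp.add_le (-x) (-y)
      rw [← neg_add] at h2
      linarith)
    (fun a x => by
      rw [Real.norm_eq_abs]
      rcases le_total 0 a with ha | ha
      · rw [abs_of_nonneg ha, ← smul_neg, hp.smul a x ha, hp.smul a (-x) ha]; ring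
      · have ha' : 0 ≤ -a := by linarith
        rw [abs_of_nonpos ha, ← neg_smul, hp.smul (-a) x ha',
          show a • x = (-a) • (-x) by simp, hp.smul (-a) (-x) ha']
        ring)

theorem toSeminorm_apply (hp : IsAsymmetricGauge D p) (x : E) :
    hp.toSeminorm x = 4 * (p x + p (-x)) := rfl

/-- The number of clusters needed to split a set of gauge radius `8 D`. -/
noncomputable def clusterNumber (n : ℕ) (D : ℝ) : ℕ :=
  ⌊(2 * (4 * (D + 1) * (8 * D)) + 1) ^ n⌋₊

theorem one_le_clusterNumber {D : ℝ} (n : ℕ) (hD : 0 ≤ D) : 1 ≤ clusterNumber n D := by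
  rw [clusterNumber, Nat.one_le_floor_iff]
  apply one_le_pow₀
  have : 0 ≤ 4 * (D + 1) * (8 * D) := by positivity
  linarith

/-- The image under `φ` is covered by `clusterNumber` unit balls of the symmetrized gauge. Two
points of one ball are at distance below 2 there, and the factor 4 in `toSeminorm` turns this into
`p ≤ 1/2`. -/
theorem measure_le_of_clusters [FiniteDimensional ℝ E] [MeasurableSpace E]
    (hp : IsAsymmetricGauge D p) (hD : 0 ≤ D) (μ : Measure E) (φ : E → E) (T : Set E)
    (hT : ∀ y ∈ T, p (-φ y) ≤ 8 * D) (κ : ℝ≥0∞)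
    (h : ∀ T' ⊆ T, (∀ y ∈ T', ∀ y' ∈ T', p (φ y - φ y') ≤ 1 / 2) → μ T' ≤ κ) :
    μ T ≤ clusterNumber (finrank ℝ E) D * κ := by
  have hq : ∀ x, hp.toSeminorm x = 0 → x = 0 := by
    intro x hx
    obtain ⟨b, hb, hn⟩ := hp.exists_norm_le
    rw [toSeminorm_apply] at hx
    have h0 : p x = 0 := by linarith [hp.nonneg x, hp.nonneg (-x)]
    have := hn x
    rw [h0, mul_zero] at this
    exact norm_le_zero_iff.1 this
  obtain ⟨s, hs, hcov⟩ := exists_finset_seminorm_cover hp.toSeminorm hq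
    (R := 4 * (D + 1) * (8 * D)) (by positivity) (φ '' T) (by
      rintro _ ⟨y, hy, rfl⟩
      have h1 := hp.neg_le (-φ y)
      rw [neg_neg] at h1
      have h2 := mul_le_mul_of_nonneg_left (hT y hy) (by positivity : 0 ≤ 4 * (D + 1))
      rw [toSeminorm_apply]
      linarith)
  have hsub : T ⊆ ⋃ f ∈ s, {y ∈ T | hp.toSeminorm (φ y - f) < 1} := by
    intro y hy
    obtain ⟨f, hf, hlt⟩ := hcov (φ y) ⟨y, hy, rfl⟩
    exact Set.mem_iUnion₂.2 ⟨f, hf, hy, hlt⟩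
  calc μ T ≤ μ (⋃ f ∈ s, {y ∈ T | hp.toSeminorm (φ y - f) < 1}) := measure_mono hsub
    _ ≤ ∑ f ∈ s, μ {y ∈ T | hp.toSeminorm (φ y - f) < 1} := measure_biUnion_finset_le _ _
    _ ≤ ∑ _f ∈ s, κ := by
      refine Finset.sum_le_sum fun f _ => h _ (fun y hy => hy.1) ?_
      intro y hy y' hy'
      have h1 : hp.toSeminorm (φ y - φ y') < 2 := by
        calc hp.toSeminorm (φ y - φ y') = hp.toSeminorm ((φ y - f) - (φ y' - f)) := by congr 1; abel
          _ ≤ hp.toSeminorm (φ y - f) + hp.toSeminorm (φ y' - f) := map_sub_le_add _ _ _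
          _ < 2 := by linarith [hy.2, hy'.2]
      rw [toSeminorm_apply] at h1
      linarith [hp.nonneg (-(φ y - φ y'))]
    _ = s.card * κ := by rw [Finset.sum_const, nsmul_eq_mul]
    _ ≤ clusterNumber (finrank ℝ E) D * κ := by
      gcongr
      exact hs

/-- Seen from `x`, if `y` and `z` lie in nearly the same direction and `y` is hardly farther than
`z`, moving to the direction of `z` costs at most half of `p (x - y)`. Since that distance exceeds
`8 * D * M`, the saving absorbs `D * M` and the rounding errors. -/
theorem sub_le_of_direction_close (hp : IsAsymmetricGauge D p) {x y z : E} {r M : ℝ}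
    (hM : 1 ≤ M) (hD : 1 ≤ D)
    (hy : 8 * D * M < p (x - y)) (hz : 8 * D * M < p (x - z)) (hzr : p (x - z) ≤ D * M + r)
    (hyz : p (x - y) ≤ p (x - z) + 1)
    (hdir : p ((p (x - y))⁻¹ • (y - x) - (p (x - z))⁻¹ • (z - x)) ≤ 1 / 2) :
    p (y - z) ≤ r - 1 := by
  set s := p (x - y)
  set t := p (x - z)
  have hDM : D ≤ D * M := le_mul_of_one_le_right (by linarith) hM
  have hs : 0 < s := by linarith
  have ht : 0 < t := by linarith
  set u := t⁻¹ • (z - x) with hu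
  set v := s⁻¹ • (y - x) with hv
  have hsv : s • v = y - x := by rw [hv, smul_inv_smul₀ hs.ne']
  have htu : t • u = z - x := by rw [hu, smul_inv_smul₀ ht.ne']
  have hnu : p (-u) = 1 := by
    rw [hu, ← smul_neg, neg_sub, hp.smul _ _ (inv_nonneg.2 ht.le)]
    exact inv_mul_cancel₀ ht.ne'
  have hpu : p u ≤ D := by
    have := hp.neg_le (-u)
    rwa [neg_neg, hnu, mul_one] at this
  have h1 : p (s • (v - u)) ≤ s * (1 / 2) := by
    rw [hp.smul _ _ hs.le]
    exact mul_le_mul_of_nonneg_left hdir hs.le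
  rcases le_total s t with hst | hst
  · have hdec : y - z = s • (v - u) + (t - s) • (-u) := by
      rw [smul_sub, sub_smul, smul_neg, smul_neg, hsv, htu]; abel
    have h2 := hp.add_le (s • (v - u)) ((t - s) • (-u))
    rw [← hdec, hp.smul _ (-u) (sub_nonneg.2 hst), hnu] at h2
    linarith
  · have hdec : y - z = s • (v - u) + (s - t) • u := by
      rw [smul_sub, sub_smul, hsv, htu]; abel
    have h2 := hp.add_le (s • (v - u)) ((s - t) • u)
    rw [← hdec, hp.smul _ u (sub_nonneg.2 hst)] at h2
    have h3 : (s - t) * p u ≤ 1 * D :=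
      mul_le_mul (by linarith) hpu (hp.nonneg u) zero_le_one
    linarith

theorem measure_intersecting_le [FiniteDimensional ℝ E] [MeasurableSpace E]
    (hp : IsAsymmetricGauge D p) (hD : 1 ≤ D) (μ : Measure E) {X : Set E}
    (hX : Bornology.IsBounded X) {m : E → ℕ} (hm2 : ∀ x ∈ X, 2 ≤ m x) {κ : ℝ≥0∞}
    (hκ : ∀ x ∈ X, μ {y | p (y - x) ≤ m x - 1} ≤ κ) {x : E} (hx : x ∈ X) :
    μ {y ∈ X | m x ≤ m y ∧ ¬ Disjoint {z | p (z - x) ≤ m x} {z | p (z - y) ≤ m y}} ≤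
      2 * clusterNumber (finrank ℝ E) D * κ := by
  set B := {y ∈ X | m x ≤ m y ∧ ¬ Disjoint {z | p (z - x) ≤ m x} {z | p (z - y) ≤ m y}} with hB
  set M : ℝ := (m x : ℝ) with hM
  have hM2 : (2 : ℝ) ≤ M := Nat.ofNat_le_cast.2 (hm2 x hx)
  have hmle : ∀ y ∈ B, M ≤ m y := fun y hy => Nat.cast_le.2 hy.2.1
  have hdist : ∀ y ∈ B, p (x - y) ≤ D * M + m y := by
    intro y hy
    obtain ⟨w, hw1, hw2⟩ := Set.not_disjoint_iff.1 hy.2.2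
    have h1 := hp.add_le (x - w) (w - y)
    rw [sub_add_sub_cancel] at h1
    have h2 := hp.neg_le (w - x)
    rw [neg_sub] at h2
    have h3 : D * p (w - x) ≤ D * M := mul_le_mul_of_nonneg_left hw1 (by linarith)
    have h4 : p (w - y) ≤ m y := hw2
    linarith
  -- Near points are clustered by position at scale `M`: a cluster has gauge diameter at most `M /
  -- 2`, and `M / 2 ≤ m z - 1` because `2 ≤ M ≤ m z`.
  have hnear : μ {y ∈ B | p (x - y) ≤ 8 * D * M} ≤ clusterNumber (finrank ℝ E) D * κ := by
    refine hp.measure_le_of_clusters (by linarith) μ (fun y => M⁻¹ • (y - x)) _ ?_ κ ?_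
    · rintro y ⟨-, hy⟩
      rw [← smul_neg, neg_sub, hp.smul _ _ (by positivity), inv_mul_le_iff₀ (by positivity)]
      linarith
    · intro T' hT' hclose
      rcases T'.eq_empty_or_nonempty with rfl | ⟨z, hz⟩
      · simp
      refine (measure_mono fun y hy => ?_).trans (hκ z (hT' hz).1.1)
      have h1 := hclose y hy z hz
      rw [← smul_sub, sub_sub_sub_cancel_right, hp.smul _ _ (by positivity),
        inv_mul_le_iff₀ (by positivity)] at h1
      have := hmle z (hT' hz).1
      change p (y - z) ≤ m z - 1
      linarith
  -- Far points are clustered by direction from `x`; the homothet of a farthest point `z` captures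
  -- its cluster.
  have hfar : μ {y ∈ B | 8 * D * M < p (x - y)} ≤ clusterNumber (finrank ℝ E) D * κ := by
    refine hp.measure_le_of_clusters (by linarith) μ (fun y => (p (x - y))⁻¹ • (y - x)) _ ?_ κ ?_
    · rintro y ⟨-, hy⟩
      have hpos : 0 < p (x - y) := lt_of_le_of_lt (by positivity) hy
      rw [← smul_neg, neg_sub, hp.smul _ _ (inv_nonneg.2 hpos.le), inv_mul_cancel₀ hpos.ne']
      linarith
    · intro T' hT' hclose
      rcases T'.eq_empty_or_nonempty with rfl | hne
      · simp
      obtain ⟨a, ha, hpa⟩ := hp.exists_le_norm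
      obtain ⟨b, hb⟩ := hX.subset_closedBall x
      -- A farthest point need not exist, so integer parts are maximized; this loses at most 1.
      have hfin : ((fun y => ⌊p (x - y)⌋₊) '' T').Finite := by
        refine (Set.finite_Iic ⌊a * b⌋₊).subset ?_
        rintro _ ⟨y, hy, rfl⟩
        refine Nat.floor_le_floor ((hpa _).trans (mul_le_mul_of_nonneg_left ?_ ha.le))
        rw [← dist_eq_norm, dist_comm]
        exact hb (hT' hy).1.1
      obtain ⟨_, ⟨z, hz, rfl⟩, hmax⟩ := hfin.exists_maximal (hne.image _)
      refine (measure_mono fun y hy => ?_).trans (hκ z (hT' hz).1.1)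
      refine hp.sub_le_of_direction_close (by linarith : 1 ≤ M) hD (hT' hy).2 (hT' hz).2
        (hdist z (hT' hz).1) ?_ (hclose y hy z hz)
      have hle : ⌊p (x - y)⌋₊ ≤ ⌊p (x - z)⌋₊ := by
        by_contra! hlt
        exact absurd (hmax ⟨y, hy, rfl⟩ hlt.le) (not_le.2 hlt)
      have h1 := Nat.lt_floor_add_one (p (x - y))
      have h2 := Nat.floor_le (hp.nonneg (x - z))
      have h3 : (⌊p (x - y)⌋₊ : ℝ) ≤ ⌊p (x - z)⌋₊ := by exact_mod_cast hle
      linarith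
  calc μ B ≤ μ ({y ∈ B | p (x - y) ≤ 8 * D * M} ∪ {y ∈ B | 8 * D * M < p (x - y)}) := by
        refine measure_mono fun y hy => ?_
        rcases le_or_gt (p (x - y)) (8 * D * M) with h | h
        · exact Or.inl ⟨hy, h⟩
        · exact Or.inr ⟨hy, h⟩
    _ ≤ _ := measure_union_le _ _
    _ ≤ _ := add_le_add hnear hfar
    _ = _ := by ring

end IsAsymmetricGauge

/-! ### Greedy selection. -/

/-- Each pick minimizes `m` on what remains, so all conflicts with later points fall in the set
bounded by `hK` and cost at most `K`. Only subadditivity of `μ` is used, so no measurability is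
needed. -/
theorem exists_pairwise_disjoint_of_measure_lt {α β : Type*} [MeasurableSpace α] (μ : Measure α)
    {X : Set α} (m : α → ℕ) (A : α → Set β) (hA : ∀ x ∈ X, (A x).Nonempty) {K : ℝ≥0∞}
    (hK : ∀ x ∈ X, μ {y ∈ X | m x ≤ m y ∧ ¬ Disjoint (A x) (A y)} ≤ K) (n : ℕ) :
    ∀ U ⊆ X, n * K < μ U → ∃ F : Finset α, (F : Set α) ⊆ U ∧ F.card = n + 1 ∧
      (F : Set α).PairwiseDisjoint A := by
  classical
  have hmin : ∀ U : Set α, U.Nonempty → ∃ x ∈ U, ∀ y ∈ U, m x ≤ m y := by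
    intro U hU
    obtain ⟨_, ⟨x, hx, rfl⟩, hle⟩ := WellFounded.has_min Nat.lt_wfRel.wf (m '' U) (hU.image m)
    exact ⟨x, hx, fun y hy => not_lt.1 (hle _ ⟨y, hy, rfl⟩)⟩
  induction n with
  | zero =>
    intro U hU hlt
    have hne : U.Nonempty := nonempty_of_measure_ne_zero (by simpa using hlt.ne')
    obtain ⟨x, hx⟩ := hne
    exact ⟨{x}, by simpa using hx, by simp, by simp⟩
  | succ n ih =>
    intro U hU hlt
    have hne : U.Nonempty := nonempty_of_measure_ne_zero ((zero_le).trans_lt hlt).ne'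
    obtain ⟨x, hxU, hx⟩ := hmin U hne
    set B := {y ∈ X | m x ≤ m y ∧ ¬ Disjoint (A x) (A y)}
    have hlt' : n * K < μ (U \ B) := by
      have h1 : μ U ≤ μ (U \ B) + K :=
        (measure_mono (by rw [Set.sdiff_union_self]; exact Set.subset_union_left)).trans
          ((measure_union_le (U \ B) B).trans (add_le_add le_rfl (hK x (hU hxU))))
      have h2 : n * K + K < μ (U \ B) + K := by
        refine lt_of_lt_of_le (lt_of_eq_of_lt ?_ hlt) h1
        push_cast
        ring
      exact lt_of_add_lt_add_right h2
    obtain ⟨F, hF, hcard, hdisj⟩ := ih (U \ B) (Set.sdiff_subset.trans hU) hlt'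
    have hxF : x ∉ F := by
      intro hxF
      refine (hF hxF).2 ⟨hU hxU, le_rfl, ?_⟩
      rw [disjoint_self]
      exact (hA x (hU hxU)).ne_empty
    refine ⟨insert x F, ?_, by rw [Finset.card_insert_of_notMem hxF, hcard], ?_⟩
    · rw [Finset.coe_insert]
      exact Set.insert_subset hxU (hF.trans Set.sdiff_subset)
    · rw [Finset.coe_insert]
      refine hdisj.insert fun y hy _ => ?_
      by_contra hcon
      exact (hF hy).2 ⟨hU (hF hy).1, hx y (hF hy).1, hcon⟩

end HomothetPacking

/-! ### The centred gauge of a convex body, and the packing it yields. -/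

namespace HomothetPacking

open Module Metric

/-- Helly for the sets `(x + n C) / (n + 1)`, `x ∈ C`: any `n + 1` of them share the centroid of
their points `x`. Writing a common point as `z = (x + n c) / (n + 1)` gives `c = z - (x - z) / n`.
-/
theorem exists_asymmetry_center {E : Type*} [NormedAddCommGroup E] [NormedSpace ℝ E]
    [FiniteDimensional ℝ E] (hn : 1 ≤ finrank ℝ E) {C : Set E} (hconv : Convex ℝ C)
    (hcomp : IsCompact C) (hint : (interior C).Nonempty) :
    ∃ z, ∀ x ∈ C, z - (finrank ℝ E : ℝ)⁻¹ • (x - z) ∈ C := by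
  classical
  have hN : (0 : ℝ) < finrank ℝ E := by exact_mod_cast hn
  set n : ℕ := finrank ℝ E with hndef
  have : Nontrivial E := Module.finrank_pos_iff.1 hn
  have hinf : C.Infinite := by
    obtain ⟨w, hw⟩ := hint
    exact infinite_of_mem_nhds w (mem_interior_iff_mem_nhds.1 hw)
  have : Infinite C := hinf.to_subtype
  let F : C → Set E := fun x => (fun c : E => ((n : ℝ) + 1)⁻¹ • (x : E) + ((n : ℝ) / (n + 1)) • c) '' C
  have hne : (⋂ x, F x).Nonempty := by
    refine Convex.helly_theorem_compact (𝕜 := ℝ) (by simp) (fun x => ?_) (fun x => ?_) ?_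
    · have := (hconv.smul ((n : ℝ) / (n + 1))).translate (((n : ℝ) + 1)⁻¹ • (x : E))
      rwa [← Set.image_smul, Set.image_image] at this
    · exact hcomp.image (by fun_prop)
    · intro I hI
      refine ⟨((n : ℝ) + 1)⁻¹ • ∑ y ∈ I, (y : E), Set.mem_iInter₂.2 fun x hx => ?_⟩
      have hcard : (I.erase x).card = n := by rw [Finset.card_erase_of_mem hx, hI]; rfl
      refine ⟨∑ y ∈ I.erase x, (n : ℝ)⁻¹ • (y : E), ?_, ?_⟩
      · refine hconv.sum_mem (fun _ _ => by positivity) ?_ (fun y _ => y.2)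
        rw [Finset.sum_const, hcard, nsmul_eq_mul, mul_inv_cancel₀ hN.ne']
      · change ((n : ℝ) + 1)⁻¹ • (x : E) + _ = _
        rw [← Finset.add_sum_erase I (fun y : C => (y : E)) hx, ← Finset.smul_sum, smul_smul,
          smul_add]
        congr 2
        field_simp
  obtain ⟨z, hz⟩ := hne
  refine ⟨z, fun x hx => ?_⟩
  obtain ⟨c, hc, hcz⟩ := Set.mem_iInter.1 hz ⟨x, hx⟩
  have : z - (n : ℝ)⁻¹ • (x - z) = c := by
    rw [← hcz]
    match_scalars <;> field_simp <;> ring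
  rwa [this]

theorem IsConvexBody.exists_gauge {d : ℕ} (hd : 1 ≤ d) {C : Set (EuclideanSpace ℝ (Fin d))}
    (hC : IsConvexBody C) : ∃ p : EuclideanSpace ℝ (Fin d) → ℝ, IsAsymmetricGauge (d : ℝ) p ∧
      ∀ (x : EuclideanSpace ℝ (Fin d)) (r : ℝ), 0 < r → IsHomothet C {y | p (y - x) ≤ r} := by
  have hD : (0 : ℝ) < d := by exact_mod_cast hd
  obtain ⟨z, hz⟩ := exists_asymmetry_center (by simpa using hd) hC.convex hC.isCompact
    hC.nonempty_interior
  rw [finrank_euclideanSpace_fin] at hz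
  -- `z` is a proper convex combination of an interior point `w` and its image `z - (w - z) / d` in
  -- `C`.
  have hzint : z ∈ interior C := by
    obtain ⟨w, hw⟩ := hC.nonempty_interior
    have h := hC.convex.combo_self_interior_mem_interior (hz w (interior_subset hw)) hw
      (by positivity : (0 : ℝ) ≤ d / (d + 1)) (by positivity : (0 : ℝ) < 1 / (d + 1))
      (by field_simp)
    convert h using 1
    match_scalars <;> field_simp <;> ring
  set K : Set (EuclideanSpace ℝ (Fin d)) := (fun v => z + v) ⁻¹' C with hK
  have hKconv : Convex ℝ K := hC.convex.translate_preimage_right z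
  have hKclosed : IsClosed K := hC.isCompact.isClosed.preimage (by fun_prop)
  have hKnhds : K ∈ nhds 0 := by
    apply ContinuousAt.preimage_mem_nhds (by fun_prop)
    rw [add_zero]
    exact mem_interior_iff_mem_nhds.1 hzint
  have habs : Absorbent ℝ K := absorbent_nhds_zero hKnhds
  have hle : ∀ x, gauge K x ≤ 1 ↔ x ∈ K := fun x => by
    rw [gauge_le_one_iff_mem_closure hKconv hKnhds, hKclosed.closure_eq]
  have hsmul : ∀ (t : ℝ) (x), 0 ≤ t → gauge K (t • x) = t * gauge K x := fun t x ht => by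
    rw [gauge_smul_of_nonneg ht, smul_eq_mul]
  obtain ⟨R, hR, hKR⟩ : ∃ R : ℝ, 0 < R ∧ K ⊆ closedBall 0 R := by
    obtain ⟨R, hR, hCR⟩ := hC.isCompact.isBounded.subset_closedBall_lt 0 z
    refine ⟨R, hR, fun v hv => ?_⟩
    simpa using hCR hv
  have hnorm : ∀ x, ‖x‖ ≤ R * gauge K x := fun x => by
    rw [← div_le_iff₀' hR]
    exact le_gauge_of_subset_closedBall habs hR.le hKR
  refine ⟨gauge K, ⟨gauge_add_le hKconv habs, hsmul, fun x => ?_, ?_, R, hR, hnorm⟩, ?_⟩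
  · rcases (gauge_nonneg (s := K) x).eq_or_lt with h0 | hpos
    · have hx0 : x = 0 := by
        have := hnorm x
        rw [← h0, mul_zero] at this
        exact norm_le_zero_iff.1 this
      simp [hx0]
    · have h1 : (gauge K x)⁻¹ • x ∈ K := by
        rw [← hle, hsmul _ _ (inv_nonneg.2 hpos.le), inv_mul_cancel₀ hpos.ne']
      have h2 : ((d : ℝ) * gauge K x)⁻¹ • (-x) ∈ K := by
        have := hz _ h1
        rw [hK, Set.mem_preimage]
        convert this using 1
        rw [add_sub_cancel_left, smul_smul, mul_inv, smul_neg, sub_eq_add_neg]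
      rw [← hle, hsmul _ _ (by positivity), inv_mul_le_iff₀ (by positivity), mul_one] at h2
      exact h2
  · obtain ⟨ε, hε, hball⟩ := Metric.mem_nhds_iff.1 hKnhds
    refine ⟨ε⁻¹, by positivity, fun x => ?_⟩
    rw [← div_eq_inv_mul, le_div_iff₀' hε]
    exact mul_gauge_le_norm hball
  · intro x r hr
    refine ⟨r, x - r • z, hr, Set.Subset.antisymm (fun y hy => ?_) ?_⟩
    · refine ⟨z + r⁻¹ • (y - x), ?_, ?_⟩
      · change r⁻¹ • (y - x) ∈ K
        rw [← hle, hsmul _ _ (inv_nonneg.2 hr.le), inv_mul_le_iff₀ hr, mul_one]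
        exact hy
      · change r • (z + r⁻¹ • (y - x)) + (x - r • z) = y
        rw [smul_add, smul_inv_smul₀ hr.ne']
        abel
    · rintro _ ⟨c, hc, rfl⟩
      have h1 : c - z ∈ K := by simpa [hK] using hc
      have h2 : r • c + (x - r • z) - x = r • (c - z) := by rw [smul_sub]; abel
      change gauge K (r • c + (x - r • z) - x) ≤ r
      rw [h2, hsmul _ _ hr.le]
      exact mul_le_of_le_one_right hr.le ((hle _).2 h1)

section Measure

variable {E : Type*} [NormedAddCommGroup E] [MeasurableSpace E] [BorelSpace E]

theorem exists_radius_measure_ball_lt (μ : Measure E) [IsFiniteMeasure μ] {X : Set E}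
    (hX : IsCompact X) {κ : ℝ≥0∞} (hκ : ∀ x, μ {x} < κ) :
    ∃ δ > 0, ∀ x ∈ X, μ (ball x δ) < κ := by
  have hopen : ∀ x : E, ∃ U, x ∈ U ∧ IsOpen U ∧ μ U < κ := by
    intro x
    obtain ⟨U, hxU, hU, hlt⟩ := Set.exists_isOpen_lt_of_lt {x} κ (hκ x)
    exact ⟨U, hxU rfl, hU, hlt⟩
  choose U hxU hU hlt using hopen
  obtain ⟨δ, hδ, h⟩ := lebesgue_number_lemma_of_metric hX hU
    (fun x _ => Set.mem_iUnion.2 ⟨x, hxU x⟩)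
  refine ⟨δ, hδ, fun x hx => ?_⟩
  obtain ⟨i, hi⟩ := h x hx
  exact (measure_mono hi).trans_lt (hlt i)

theorem IsAsymmetricGauge.exists_packing [NormedSpace ℝ E] [FiniteDimensional ℝ E] {D : ℝ}
    {p : E → ℝ} (hp : IsAsymmetricGauge D p) (hD : 1 ≤ D) (μ : Measure E) [IsFiniteMeasure μ]
    {X : Set E} (hX : IsCompact X) (hXμ : μ X = μ Set.univ) {k : ℝ} (hk : 0 < k)
    (hkμ : ENNReal.ofReal k ≤ μ Set.univ) (hatom : ∀ x, μ {x} < ENNReal.ofReal k) :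
    ∃ (F : Finset E) (r : E → ℝ),
      (∀ x ∈ F, 0 < r x ∧ ENNReal.ofReal k ≤ μ {y | p (y - x) ≤ r x}) ∧
      (F : Set E).PairwiseDisjoint (fun x => {y | p (y - x) ≤ r x}) ∧
      (μ Set.univ).toReal / k ≤ 2 * clusterNumber (finrank ℝ E) D * F.card := by
  obtain ⟨δ, hδ, hsmall⟩ := exists_radius_measure_ball_lt μ hX hatom
  obtain ⟨b, hb, hbp⟩ := hp.exists_norm_le
  -- In this unit, a homothet of radius 1 lies in a norm ball of radius `δ / 2`, so its measure is
  -- below `k` and `m ≥ 2` on `X`.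
  set ε := δ / (2 * b) with hε
  have hεpos : 0 < ε := by positivity
  have hp' := hp.const_mul (inv_pos.2 hεpos)
  set q : E → ℝ := fun x => ε⁻¹ * p x with hq
  have hqp : ∀ x t, q x ≤ t ↔ p x ≤ ε * t := fun x t => inv_mul_le_iff₀ hεpos
  have hq1 : ∀ x ∈ X, μ {y | q (y - x) ≤ 1} < ENNReal.ofReal k := by
    refine fun x hx => (measure_mono fun y hy => ?_).trans_lt (hsmall x hx)
    have h1 := (hqp _ _).1 hy
    rw [mem_ball, dist_eq_norm]
    calc ‖y - x‖ ≤ b * p (y - x) := hbp _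
      _ ≤ b * (ε * 1) := mul_le_mul_of_nonneg_left h1 hb.le
      _ = δ / 2 := by rw [hε]; field_simp
      _ < δ := half_lt_self hδ
  have hex : ∀ x : E, ∃ n : ℕ, ENNReal.ofReal k ≤ μ {y | q (y - x) ≤ n} := by
    intro x
    obtain ⟨a, ha, hqa⟩ := hp'.exists_le_norm
    obtain ⟨R, hR⟩ := hX.isBounded.subset_closedBall x
    obtain ⟨n, hn⟩ := exists_nat_ge (a * R)
    refine ⟨n, (hkμ.trans_eq hXμ.symm).trans (measure_mono fun y hy => ?_)⟩
    refine (hqa _).trans ((mul_le_mul_of_nonneg_left ?_ ha.le).trans hn)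
    rw [← dist_eq_norm]
    exact hR hy
  classical
  let m : E → ℕ := fun x => Nat.find (hex x)
  have hmspec : ∀ x, ENNReal.ofReal k ≤ μ {y | q (y - x) ≤ m x} := fun x => Nat.find_spec (hex x)
  have hm2 : ∀ x ∈ X, 2 ≤ m x := by
    intro x hx
    by_contra! hlt
    refine ((hmspec x).trans (measure_mono fun y (hy : q (y - x) ≤ m x) => ?_)).not_gt (hq1 x hx)
    have : (m x : ℝ) ≤ 1 := by exact_mod_cast Nat.le_of_lt_succ hlt
    exact hy.trans this
  have hκ : ∀ x ∈ X, μ {y | q (y - x) ≤ m x - 1} ≤ ENNReal.ofReal k := by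
    intro x hx
    have h1 : ¬ _ := Nat.find_min (hex x) (m := m x - 1) (by have := hm2 x hx; change _ < m x; omega)
    rw [Nat.cast_sub (by have := hm2 x hx; omega), Nat.cast_one] at h1
    exact (not_le.1 h1).le
  set N := clusterNumber (finrank ℝ E) D
  have hN : (1 : ℝ) ≤ N := by
    exact_mod_cast IsAsymmetricGauge.one_le_clusterNumber _ (zero_le_one.trans hD)
  set M := (μ Set.univ).toReal with hM
  have hMk : k ≤ M := (ENNReal.ofReal_le_iff_le_toReal (measure_ne_top _ _)).1 hkμ
  have hMpos : 0 < M := hk.trans_le hMk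
  have hceil : 0 < ⌈M / (2 * N * k)⌉₊ := Nat.ceil_pos.2 (by positivity)
  -- The greedy lemma yields `n + 1` sets from the strict bound on `n`, so the full ceiling is
  -- reached.
  obtain ⟨n, hn⟩ : ∃ n, ⌈M / (2 * N * k)⌉₊ = n + 1 := ⟨_, (Nat.succ_pred_eq_of_pos hceil).symm⟩
  have hnlt : (n : ℝ) * (2 * N * k) < M := by
    rw [← lt_div_iff₀ (by positivity)]
    exact Nat.lt_ceil.1 (by omega)
  obtain ⟨F, hFX, hcard, hdisj⟩ := exists_pairwise_disjoint_of_measure_lt μ m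
    (fun x => {y | q (y - x) ≤ m x})
    (fun x _ => ⟨x, by simp [hp'.map_zero]⟩)
    (fun x hx => hp'.measure_intersecting_le hD μ hX.isBounded hm2 hκ hx) n X subset_rfl (by
      rw [hXμ, ← ENNReal.ofReal_toReal (measure_ne_top μ Set.univ)]
      convert (ENNReal.ofReal_lt_ofReal_iff hMpos).2 hnlt using 1
      rw [ENNReal.ofReal_mul (by positivity), ENNReal.ofReal_mul (by positivity),
        ENNReal.ofReal_mul (by positivity), ENNReal.ofReal_natCast, ENNReal.ofReal_natCast,
        ENNReal.ofReal_ofNat])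
  have hset : ∀ x, {y | p (y - x) ≤ ε * m x} = {y | q (y - x) ≤ m x} :=
    fun x => Set.ext fun y => (hqp _ _).symm
  refine ⟨F, fun x => ε * m x, fun x hx => ⟨?_, ?_⟩, ?_, ?_⟩
  · have := hm2 x (hFX hx)
    have : 0 < m x := by omega
    positivity
  · rw [hset]
    exact hmspec x
  · simp_rw [hset]
    exact hdisj
  · have h1 := Nat.le_ceil (M / (2 * N * k))
    rw [hn, div_le_iff₀ (by positivity)] at h1
    rw [div_le_iff₀ hk, hcard]
    linarith

end Measure

theorem le_maxPacking {d : ℕ} {Q : Set (EuclideanSpace ℝ (Fin d)) → Prop}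
    (F : Finset (EuclideanSpace ℝ (Fin d)))
    (A : EuclideanSpace ℝ (Fin d) → Set (EuclideanSpace ℝ (Fin d))) (hQ : ∀ x ∈ F, Q (A x))
    (hne : ∀ x ∈ F, (A x).Nonempty) (hdisj : (F : Set _).PairwiseDisjoint A) :
    (F.card : ℕ∞) ≤ maxPacking Q := by
  have hinj : Set.InjOn A F := by
    intro x hx y hy hxy
    by_contra hcon
    have h : Disjoint (A x) (A y) := hdisj hx hy hcon
    rw [← hxy, disjoint_self] at h
    exact (hne x hx).ne_empty h
  rw [← Set.encard_coe_eq_coe_finsetCard, ← hinj.encard_image]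
  refine le_iSup₂_of_le (A '' F) ⟨?_, ?_⟩ le_rfl
  · rintro _ ⟨x, hx, rfl⟩
    exact hQ x hx
  · rintro _ ⟨x, hx, rfl⟩ _ ⟨y, hy, rfl⟩ hxy
    exact (hdisj hx hy fun h => hxy (by rw [h])).mono interior_subset interior_subset

theorem IsConvexBody.le_maxPacking_of_measure {d : ℕ} (hd : 1 ≤ d)
    {C : Set (EuclideanSpace ℝ (Fin d))} (hC : IsConvexBody C)
    (μ : Measure (EuclideanSpace ℝ (Fin d))) [IsFiniteMeasure μ]
    {X : Set (EuclideanSpace ℝ (Fin d))} (hX : IsCompact X) (hXμ : μ X = μ Set.univ) {k : ℝ}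
    (hk : 0 < k) (hkμ : ENNReal.ofReal k ≤ μ Set.univ) (hatom : ∀ x, μ {x} < ENNReal.ofReal k) :
    ENNReal.ofReal (1 / (2 * IsAsymmetricGauge.clusterNumber d d) * ((μ Set.univ).toReal / k)) ≤
      (maxPacking (fun A => IsHomothet C A ∧ ENNReal.ofReal k ≤ μ A) : ℝ≥0∞) := by
  have hD : (1 : ℝ) ≤ d := by exact_mod_cast hd
  obtain ⟨p, hp, hhom⟩ := hC.exists_gauge hd
  obtain ⟨F, r, hF, hdisj, hcard⟩ := hp.exists_packing hD μ hX hXμ hk hkμ hatom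
  rw [finrank_euclideanSpace_fin] at hcard
  have hN : (0 : ℝ) < IsAsymmetricGauge.clusterNumber d d := by
    exact_mod_cast IsAsymmetricGauge.one_le_clusterNumber d (zero_le_one.trans hD)
  have hle : (F.card : ℕ∞) ≤ maxPacking (fun A => IsHomothet C A ∧ ENNReal.ofReal k ≤ μ A) := by
    refine le_maxPacking F (fun x => {y | p (y - x) ≤ r x})
      (fun x hx => ⟨hhom x _ (hF x hx).1, (hF x hx).2⟩) (fun x hx => ⟨x, ?_⟩) hdisj
    simpa [hp.map_zero] using (hF x hx).1.le
  calc _ ≤ ENNReal.ofReal F.card := by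
        apply ENNReal.ofReal_le_ofReal
        rw [one_div, inv_mul_le_iff₀ (by positivity)]
        exact hcard
    _ = ((F.card : ℕ∞) : ℝ≥0∞) := by simp
    _ ≤ _ := ENat.toENNReal_le.2 hle

/-- A translate moves a boundary point of `C` to `x`. Nondegeneracy thus bounds the mass of single
points, its only role in the proof. -/
theorem IsConvexBody.exists_homothet_mem_frontier {d : ℕ} (hd : 1 ≤ d)
    {C : Set (EuclideanSpace ℝ (Fin d))} (hC : IsConvexBody C) (x : EuclideanSpace ℝ (Fin d)) :
    ∃ A, IsHomothet C A ∧ x ∈ frontier A := by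
  have : Nonempty (Fin d) := ⟨⟨0, hd⟩⟩
  obtain ⟨c, hc⟩ : (frontier C).Nonempty := by
    rw [nonempty_frontier_iff]
    refine ⟨hC.nonempty_interior.mono interior_subset, fun h => ?_⟩
    exact noncompact_univ (EuclideanSpace ℝ (Fin d)) (h ▸ hC.isCompact)
  refine ⟨(fun y => y + (x - c)) '' C, ⟨1, x - c, one_pos, by simp⟩, ?_⟩
  have h := (Homeomorph.addRight (x - c)).image_frontier C
  rw [Homeomorph.coe_addRight] at h
  rw [← h]
  exact ⟨c, hc, by simp⟩

theorem IsHomothet.isCompact {d : ℕ} {C A : Set (EuclideanSpace ℝ (Fin d))} (hC : IsCompact C)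
    (hA : IsHomothet C A) : IsCompact A := by
  obtain ⟨l, x, -, rfl⟩ := hA
  exact hC.image (by fun_prop)

theorem maxPacking_congr {d : ℕ} {Q Q' : Set (EuclideanSpace ℝ (Fin d)) → Prop}
    (h : ∀ A, Q A ↔ Q' A) : maxPacking Q = maxPacking Q' := by
  rw [show Q = Q' from funext fun A => propext (h A)]

end HomothetPacking

theorem mainTheorem2 (d : ℕ) (hd : 1 ≤ d) :
    ∃ c : ℝ, 0 < c ∧
      (∀ C : Set (EuclideanSpace ℝ (Fin d)), HomothetPacking.IsConvexBody C →
        ∀ k : ℕ, 0 < k → ∀ S : Finset (EuclideanSpace ℝ (Fin d)),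
          HomothetPacking.NonDegenerateSet C ((k : ℝ) / 2) S → k ≤ S.card →
            ENNReal.ofReal (c * ((S.card : ℝ) / (k : ℝ))) ≤
              ((HomothetPacking.gSet C (k : ℝ) S : ℕ∞) : ℝ≥0∞)) ∧
      (∀ C : Set (EuclideanSpace ℝ (Fin d)), HomothetPacking.IsConvexBody C →
        ∀ k : ℝ, 0 < k → ∀ μ : Measure (EuclideanSpace ℝ (Fin d)),
          HomothetPacking.IsNice C μ → ENNReal.ofReal k ≤ μ Set.univ →
            ENNReal.ofReal (c * ((μ Set.univ).toReal / k)) ≤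
              ((HomothetPacking.gMeasure C k μ : ℕ∞) : ℝ≥0∞)) := by
  open HomothetPacking in
  have hN : 1 ≤ IsAsymmetricGauge.clusterNumber d d :=
    IsAsymmetricGauge.one_le_clusterNumber d (Nat.cast_nonneg d)
  refine ⟨1 / (2 * IsAsymmetricGauge.clusterNumber d d), by positivity, ?_, ?_⟩
  · intro C hC k hk S hS hkS
    set μ : Measure (EuclideanSpace ℝ (Fin d)) :=
      Measure.count.restrict (S : Set (EuclideanSpace ℝ (Fin d))) with hμ
    have hμA : ∀ A, μ A = (((S : Set (EuclideanSpace ℝ (Fin d))) ∩ A).ncard : ℝ≥0∞) := by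
      intro A
      rw [hμ, Measure.restrict_apply' S.measurableSet, Set.inter_comm,
        Measure.count_apply_finite _ (S.finite_toSet.inter_of_left A),
        Set.ncard_eq_toFinset_card _ (S.finite_toSet.inter_of_left A)]
    have huniv : μ Set.univ = S.card := by
      rw [hμA, Set.inter_univ, Set.ncard_coe_finset]
    have : IsFiniteMeasure μ := ⟨by rw [huniv]; exact ENNReal.natCast_lt_top _⟩
    -- A point of `S` lies on the boundary of some homothet, so `1 ≤ k / 2`; hence the atoms, of
    -- mass 1, weigh less than `k`.
    have hk2 : 2 ≤ k := by
      obtain ⟨x, hx⟩ := Finset.card_pos.1 (hk.trans_le hkS)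
      obtain ⟨A, hA, hxA⟩ := hC.exists_homothet_mem_frontier hd x
      have h1 : 0 < ((S : Set (EuclideanSpace ℝ (Fin d))) ∩ frontier A).ncard :=
        (Set.ncard_pos (S.finite_toSet.inter_of_left _)).2 ⟨x, hx, hxA⟩
      have h2 : (1 : ℝ) ≤ ((S : Set (EuclideanSpace ℝ (Fin d))) ∩ frontier A).ncard := by
        exact_mod_cast h1
      have h3 : (2 : ℝ) ≤ k := by linarith [hS A hA]
      exact_mod_cast h3
    have hmain := hC.le_maxPacking_of_measure hd μ (X := S) S.finite_toSet.isCompact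
      (by rw [hμA, Set.inter_self, huniv, Set.ncard_coe_finset]) (k := k) (by positivity)
      (by rw [huniv, ENNReal.ofReal_natCast]; exact_mod_cast hkS)
      (fun x => by
        rw [hμA, ENNReal.ofReal_natCast]
        have h1 : ((S : Set (EuclideanSpace ℝ (Fin d))) ∩ {x}).ncard ≤ 1 :=
          (Set.ncard_le_ncard Set.inter_subset_right).trans_eq (Set.ncard_singleton x)
        exact_mod_cast h1.trans_lt hk2)
    rw [huniv, ENNReal.toReal_natCast] at hmain
    refine hmain.trans_eq ?_
    rw [gSet]
    congr 1
    refine maxPacking_congr fun A => and_congr_right fun _ => ?_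
    rw [hμA, ENNReal.ofReal_natCast]
    norm_cast
  · intro C hC k hk μ hμ hkμ
    have : IsFiniteMeasure μ := ⟨hμ.finite⟩
    obtain ⟨x, r, -, hball⟩ := hμ.ball
    refine hC.le_maxPacking_of_measure hd μ (isCompact_closedBall x r)
      (le_antisymm (measure_mono (Set.subset_univ _))
        (hball.symm.trans_le (measure_mono Metric.ball_subset_closedBall))) hk hkμ fun y => ?_
    obtain ⟨A, hA, hyA⟩ := hC.exists_homothet_mem_frontier hd y
    rw [measure_mono_null (Set.singleton_subset_iff.2 hyA) (hμ.nonDegenerate A hA)]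
    exact ENNReal.ofReal_pos.2 hk
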